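/- Let $n\ge 0$ and $r\ge 0$ be integers, and let $F_1,\ldots,F_r$ be linear subspaces of $\mathbb{R}^n$ that form an $s$-uniform cover of $\mathbb{R}^n$ with weights $c_1,\ldots,c_r$; that is, $s>0$ and $c_1,\ldots,c_r>0$ are real numbers such that $$ s I_n=\sum_{i=1}^r c_i P_{F_i}, $$ where $I_n$ is the identity operator on $\mathbb{R}^n$ and $P_{F_i}$ is the orthogonal projection of $\mathbb{R}^n$ onto $F_i$. Then every compact set $K\subseteq\mathbb{R}^n$ satisfies $$ |K|^s\le\prod_{i=1}^r |P_{F_i}(K)|^{c_i}, $$ where $|K|$ is the $n$-dimensional Lebesgue measure of $K$ and $|P_{F_i}(K)|$ is the measure of $P_{F_i}(K)$ with respect to the Lebesgue measure on $F_i$ induced by the Euclidean structure (on $F_i=\{0\}$ this is the unit point mass at $0$). -/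

import Mathlib

/-- The subspaces `F i` of `ℝⁿ` form an `s`-uniform cover of `ℝⁿ` with weights `c i`:
`s > 0`, all the weights are positive, and `s Iₙ = ∑ i, c i • P i`, where `P i` is the
orthogonal projection of `ℝⁿ` onto `F i` (as an operator on `ℝⁿ`). -/
structure IsUniformCover {n r : ℕ} (F : Fin r → Submodule ℝ (EuclideanSpace ℝ (Fin n)))
    (s : ℝ) (c : Fin r → ℝ) : Prop where
  pos : 0 < s
  weight_pos : ∀ i, 0 < c i
  sum_eq : s • ContinuousLinearMap.id ℝ (EuclideanSpace ℝ (Fin n)) =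
    ∑ i, c i • (F i).starProjection

/-!
The inequality is the geometric Brascamp-Lieb inequality for indicator functions. After dividing the
weights by `s` one may assume `∑ c i • P i = 1`, where `P i` is the orthogonal projection onto
`F i`. The proof runs the heat flow in small discrete time steps.

Let `f i` be bounded `C^{1,1}` functions, bounded below by a positive constant, that depend only on
the component of the variable in `F i`. Average them over a Gaussian of small standard deviation
`σ`, centred at a point `x`. If `p i` is the average of `f i` and `f i = p i * (1 + θ i)`, then
`∏ (1 + θ i) ^ c i` is at most `1 + A + (A ^ 2 - B) / 2` plus a cubic error, where
`A = ∑ c i * θ i` and `B = ∑ c i * θ i ^ 2` (`exists_prod_one_add_rpow_le`). The linear term `A` averages to zero, and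
to leading order `θ i` is `σ * ⟪b i, z⟫` for a vector `b i` in `F i`, so that `A ^ 2 - B` averages to
`σ ^ 2 * (‖∑ c i • b i‖ ^ 2 - ∑ c i * ‖b i‖ ^ 2)`. This is nonpositive because of the decomposition
of the identity (`norm_sum_smul_sq_le`). Hence averaging the geometric mean of the `f i` gives at
most `1 + O(σ ^ 3)` times the geometric mean of their averages (`exists_gaussAvg_prod_rpow_le`). The
constant is uniform because averaging preserves the bounds on the functions and their gradients
(`HasTameGradient.gaussAvg`). With `N` steps of size `σ = 1 / √N`, the semigroup property
`gaussAvg_gaussAvg` adds them up to the standard Gaussian measure `γ`, the accumulated error factor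
tends to `1`, and `∫ ∏ f i ^ c i ∂γ ≤ ∏ (∫ f i ∂γ) ^ c i` follows (`integral_prod_rpow_le`).

Smooth approximations of the indicator functions of the projections of `K` turn this into
`γ K ≤ ∏ γ (P i K) ^ c i` (`stdGaussian_real_le_prod`). Applied to `l • K` with `l → 0`, where the
Gaussian measure is comparable to the Lebesgue measure, it gives the claim: the normalizing factors
cancel since `∑ c i * dim (F i)` is the dimension of the space, by taking traces
(`sum_mul_finrank_eq`).
-/

open MeasureTheory ProbabilityTheory Filter Topology
open scoped RealInnerProductSpace ENNReal

section BrascampLieb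

/-! ### Expansion of weighted geometric means -/

/-- The cubic Taylor polynomial of `log (1 + x)` is an upper bound on the whole domain, so that no
lower bound on `1 + x` is needed. -/
theorem log_one_add_le_cubic {x : ℝ} (hx : -1 < x) :
    Real.log (1 + x) ≤ x - x ^ 2 / 2 + x ^ 3 / 3 := by
  let f : ℝ → ℝ := fun x ↦ x - x ^ 2 / 2 + x ^ 3 / 3 - Real.log (1 + x)
  have hd : ∀ y : ℝ, -1 < y → HasDerivAt f (y ^ 3 / (1 + y)) y := by
    intro y hy
    have hy' : 1 + y ≠ 0 := by linarith
    have h1 : HasDerivAt (fun x : ℝ ↦ Real.log (1 + x)) (1 / (1 + y)) y :=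
      ((hasDerivAt_id y).const_add 1).log hy'
    have h2 := (((hasDerivAt_id y).sub (((hasDerivAt_id y).pow 2).div_const 2)).add
      (((hasDerivAt_id y).pow 3).div_const 3)).sub h1
    refine h2.congr_deriv ?_
    simp only [id]
    field_simp
    ring
  have h0 : f 0 = 0 := by simp [f]
  have key : 0 ≤ f x := by
    rcases le_total 0 x with h | h
    · have hm : MonotoneOn f (Set.Ici 0) := by
        refine monotoneOn_of_deriv_nonneg (convex_Ici 0) ?_ ?_ ?_
        · intro y hy
          exact (hd y (by simp at hy; linarith)).continuousAt.continuousWithinAt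
        · intro y hy
          rw [interior_Ici] at hy
          exact (hd y (by simp at hy; linarith)).differentiableAt.differentiableWithinAt
        · intro y hy
          rw [interior_Ici] at hy
          have hy : 0 < y := hy
          rw [(hd y (by linarith)).deriv]
          positivity
      rw [← h0]
      exact hm (by simp) h h
    · have hm : AntitoneOn f (Set.Ioc (-1) 0) := by
        refine antitoneOn_of_deriv_nonpos (convex_Ioc _ _) ?_ ?_ ?_
        · intro y hy
          exact (hd y hy.1).continuousAt.continuousWithinAt
        · intro y hy
          rw [interior_Ioc] at hy
          exact (hd y hy.1).differentiableAt.differentiableWithinAt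
        · intro y hy
          rw [interior_Ioc] at hy
          rw [(hd y hy.1).deriv]
          refine div_nonpos_of_nonpos_of_nonneg ?_ (by linarith [hy.1])
          exact (Odd.pow_nonpos_iff (by decide)).2 hy.2.le
      rw [← h0]
      exact hm ⟨hx, h⟩ ⟨by norm_num, le_rfl⟩ h
  simp only [f] at key
  linarith

theorem exp_le_quadratic_add (y : ℝ) :
    Real.exp y ≤ 1 + y + y ^ 2 / 2 + |y| ^ 3 * Real.exp |y| := by
  have h := Complex.norm_exp_sub_sum_le_norm_mul_exp (y : ℂ) 3
  have e : Complex.exp (y : ℂ) - ∑ m ∈ Finset.range 3, (y : ℂ) ^ m / (m.factorial : ℂ)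
      = ((Real.exp y - (1 + y + y ^ 2 / 2) : ℝ) : ℂ) := by
    simp [Finset.sum_range_succ, Nat.factorial]
  rw [e, Complex.norm_real, Complex.norm_real, Real.norm_eq_abs, Real.norm_eq_abs] at h
  linarith [le_abs_self (Real.exp y - (1 + y + y ^ 2 / 2))]

/-- Second order expansion of a weighted geometric mean of numbers `1 + θ i`, with a one-sided
cubic error that is uniform in `θ`. -/
theorem exists_prod_one_add_rpow_le {ι : Type*} [Fintype ι] (c : ι → ℝ) (hc : ∀ i, 0 ≤ c i)
    (T : ℝ) (hT : 0 ≤ T) :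
    ∃ D : ℝ, 0 ≤ D ∧ ∀ (θ : ι → ℝ) (t : ℝ), (∀ i, -1 < θ i) → (∀ i, |θ i| ≤ t) → 0 ≤ t → t ≤ T →
      ∏ i, (1 + θ i) ^ c i ≤
        1 + ∑ i, c i * θ i + ((∑ i, c i * θ i) ^ 2 - ∑ i, c i * θ i ^ 2) / 2 + D * t ^ 3 := by
  set S : ℝ := ∑ i, c i with hS
  have hS0 : 0 ≤ S := Finset.sum_nonneg fun i _ ↦ hc i
  set U : ℝ := 1 + T with hU
  have hU0 : 0 ≤ U := by positivity
  refine ⟨S / 3 + S * U * (S * (2 + U * T)) / 2 +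
    (S * (1 + U * T)) ^ 3 * Real.exp (S * (1 + U * T) * T), by positivity, ?_⟩
  intro θ t h1 ht ht0 htT
  set A := ∑ i, c i * θ i with hA
  set B := ∑ i, c i * θ i ^ 2 with hB
  set C := ∑ i, c i * θ i ^ 3 with hC
  have hAb : |A| ≤ S * t := by
    rw [hA, hS, Finset.sum_mul]
    refine (Finset.abs_sum_le_sum_abs _ _).trans (Finset.sum_le_sum fun i _ ↦ ?_)
    rw [abs_mul, abs_of_nonneg (hc i)]
    exact mul_le_mul_of_nonneg_left (ht i) (hc i)
  have hBb : |B| ≤ S * t ^ 2 := by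
    rw [hB, hS, Finset.sum_mul]
    refine (Finset.abs_sum_le_sum_abs _ _).trans (Finset.sum_le_sum fun i _ ↦ ?_)
    rw [abs_mul, abs_of_nonneg (hc i), abs_pow]
    exact mul_le_mul_of_nonneg_left (pow_le_pow_left₀ (abs_nonneg _) (ht i) _) (hc i)
  have hCb : |C| ≤ S * t ^ 3 := by
    rw [hC, hS, Finset.sum_mul]
    refine (Finset.abs_sum_le_sum_abs _ _).trans (Finset.sum_le_sum fun i _ ↦ ?_)
    rw [abs_mul, abs_of_nonneg (hc i), abs_pow]
    exact mul_le_mul_of_nonneg_left (pow_le_pow_left₀ (abs_nonneg _) (ht i) _) (hc i)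
  -- The exponent is `A + R` with `A = O(t)` and `R = O(t ^ 2)`. As `t ≤ T`, a factor `t` can be
  -- traded for `T` to lower the order of a bound.
  set R := -B / 2 + C / 3 with hR
  have hRb : |R| ≤ S * U * t ^ 2 := by
    have h3 : S * t ^ 3 ≤ S * T * t ^ 2 := by
      have := mul_le_mul_of_nonneg_left htT (mul_nonneg hS0 (sq_nonneg t))
      nlinarith
    have hp : 0 ≤ S * t ^ 2 := by positivity
    have hp' : 0 ≤ S * T * t ^ 2 := by positivity
    have e : S * U * t ^ 2 = S * t ^ 2 + S * T * t ^ 2 := by rw [hU]; ring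
    rw [e, hR]
    rw [abs_le] at hBb hCb ⊢
    constructor <;> linarith
  have hRt : |R| ≤ S * (U * T) * t := by
    refine hRb.trans ?_
    have := mul_le_mul_of_nonneg_left htT (mul_nonneg (mul_nonneg hS0 hU0) ht0)
    nlinarith
  have hlog : ∏ i, (1 + θ i) ^ c i ≤ Real.exp (A + R) := by
    have e : A + R = ∑ i, c i * (θ i - θ i ^ 2 / 2 + θ i ^ 3 / 3) := by
      rw [hR, hA, hB, hC]
      simp only [neg_div, Finset.sum_div, ← Finset.sum_neg_distrib, ← Finset.sum_add_distrib]
      exact Finset.sum_congr rfl fun i _ ↦ by ring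
    rw [e, Real.exp_sum]
    refine Finset.prod_le_prod (fun i _ ↦ Real.rpow_nonneg (by linarith [h1 i]) _) fun i _ ↦ ?_
    rw [Real.rpow_def_of_pos (by linarith [h1 i]), mul_comm]
    exact Real.exp_le_exp.2 (mul_le_mul_of_nonneg_left (log_one_add_le_cubic (h1 i)) (hc i))
  have hy : |A + R| ≤ S * (1 + U * T) * t := by
    refine (abs_add_le _ _).trans ?_
    have : S * (1 + U * T) * t = S * t + S * (U * T) * t := by ring
    linarith
  have hyT : |A + R| ≤ S * (1 + U * T) * T :=
    hy.trans (mul_le_mul_of_nonneg_left htT (by positivity))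
  have hquad : (A + R) ^ 2 ≤ A ^ 2 + S * U * (S * (2 + U * T)) * t ^ 3 := by
    have e : (A + R) ^ 2 = A ^ 2 + R * (2 * A + R) := by ring
    have h2 : |2 * A + R| ≤ S * (2 + U * T) * t := by
      refine (abs_add_le _ _).trans ?_
      rw [abs_mul, abs_two]
      have : S * (2 + U * T) * t = 2 * (S * t) + S * (U * T) * t := by ring
      linarith
    have h3 : |R * (2 * A + R)| ≤ (S * U * t ^ 2) * (S * (2 + U * T) * t) := by
      rw [abs_mul]
      exact mul_le_mul hRb h2 (abs_nonneg _) (by positivity)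
    have h4 := (le_abs_self _).trans h3
    have e2 : (S * U * t ^ 2) * (S * (2 + U * T) * t) = S * U * (S * (2 + U * T)) * t ^ 3 := by ring
    linarith
  have hcube : |A + R| ^ 3 * Real.exp |A + R| ≤
      (S * (1 + U * T)) ^ 3 * Real.exp (S * (1 + U * T) * T) * t ^ 3 := by
    have := mul_le_mul (pow_le_pow_left₀ (abs_nonneg _) hy 3) (Real.exp_le_exp.2 hyT)
      (Real.exp_pos _).le (by positivity)
    refine this.trans_eq (by ring)
  have hfin := exp_le_quadratic_add (A + R)
  have hRu : R ≤ -B / 2 + S * t ^ 3 / 3 := by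
    rw [hR]; linarith [le_abs_self C]
  refine hlog.trans (hfin.trans ?_)
  have e3 : (S / 3 + S * U * (S * (2 + U * T)) / 2 +
    (S * (1 + U * T)) ^ 3 * Real.exp (S * (1 + U * T) * T)) * t ^ 3 =
    S * t ^ 3 / 3 + S * U * (S * (2 + U * T)) * t ^ 3 / 2 +
    (S * (1 + U * T)) ^ 3 * Real.exp (S * (1 + U * T) * T) * t ^ 3 := by ring
  rw [e3]
  linarith

/-! ### Subspaces decomposing the identity -/

variable {E : Type*} [NormedAddCommGroup E] [InnerProductSpace ℝ E]

/-- If `∑ c i • P (F i)` is the identity, then vectors `b i ∈ F i` satisfy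
`‖∑ c i • b i‖² ≤ ∑ c i ‖b i‖²`. -/
theorem norm_sum_smul_sq_le {ι : Type*} [Fintype ι] {F : ι → Submodule ℝ E}
    [∀ i, (F i).HasOrthogonalProjection] {c : ι → ℝ} (hc : ∀ i, 0 ≤ c i)
    (hF : ∀ x, ∑ i, c i • (F i).starProjection x = x) (b : ∀ i, F i) :
    ‖∑ i, c i • (b i : E)‖ ^ 2 ≤ ∑ i, c i * ‖b i‖ ^ 2 := by
  set v := ∑ i, c i • (b i : E) with hv
  have h1 : ‖v‖ ^ 2 = ∑ i, c i * ⟪b i, (F i).orthogonalProjectionOnto v⟫ := by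
    rw [← real_inner_self_eq_norm_sq]
    nth_rw 1 [hv]
    rw [sum_inner]
    refine Finset.sum_congr rfl fun i _ ↦ ?_
    rw [real_inner_smul_left, Submodule.inner_orthogonalProjectionOnto_eq_of_mem_left]
  have h2 : ‖v‖ ^ 2 = ∑ i, c i * ‖(F i).orthogonalProjectionOnto v‖ ^ 2 := by
    rw [← real_inner_self_eq_norm_sq]
    nth_rw 1 [← hF v]
    rw [sum_inner]
    refine Finset.sum_congr rfl fun i _ ↦ ?_
    rw [real_inner_smul_left, Submodule.starProjection_apply,
      ← Submodule.inner_orthogonalProjectionOnto_eq_of_mem_left, real_inner_self_eq_norm_sq]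
  have h3 : ‖v‖ ^ 2 ≤ ∑ i, c i * ((‖b i‖ ^ 2 + ‖(F i).orthogonalProjectionOnto v‖ ^ 2) / 2) := by
    rw [h1]
    refine Finset.sum_le_sum fun i _ ↦ mul_le_mul_of_nonneg_left ?_ (hc i)
    have := real_inner_le_norm (b i) ((F i).orthogonalProjectionOnto v)
    nlinarith [sq_nonneg (‖b i‖ - ‖(F i).orthogonalProjectionOnto v‖)]
  have h4 : ∑ i, c i * ((‖b i‖ ^ 2 + ‖(F i).orthogonalProjectionOnto v‖ ^ 2) / 2) =
      (∑ i, c i * ‖b i‖ ^ 2) / 2 + ‖v‖ ^ 2 / 2 := by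
    rw [h2, Finset.sum_div, Finset.sum_div, ← Finset.sum_add_distrib]
    exact Finset.sum_congr rfl fun i _ ↦ by ring
  linarith

section Trace

variable [FiniteDimensional ℝ E]

/-- The trace of the decomposition of the identity. -/
theorem sum_mul_finrank_eq {ι : Type*} [Fintype ι] {F : ι → Submodule ℝ E}
    {c : ι → ℝ} (hF : ∀ x, ∑ i, c i • (F i).starProjection x = x) :
    ∑ i, c i * Module.finrank ℝ (F i) = Module.finrank ℝ E := by
  have h : ∑ i, c i • ((F i).starProjection : E →ₗ[ℝ] E) = LinearMap.id := by
    ext x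
    simpa using hF x
  have h2 := congrArg (LinearMap.trace ℝ E) h
  rw [map_sum, LinearMap.trace_id] at h2
  rw [← h2]
  refine Finset.sum_congr rfl fun i _ ↦ ?_
  have hp : LinearMap.IsProj (F i) ((F i).starProjection : E →ₗ[ℝ] E) :=
    ⟨fun x ↦ (F i).starProjection_apply_mem x,
      fun x hx ↦ Submodule.starProjection_eq_self_iff.2 hx⟩
  rw [map_smul, hp.trace, smul_eq_mul]

end Trace

/-! ### Functions with bounded Lipschitz gradient in a subspace -/

/-- The function `f` takes values in `[m, M]` and is of class `C^{1,1}` with constants bounded by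
`L`, and its gradient `a` takes values in the subspace `F`. The gradient is encoded by the second
order Taylor estimate, which is stable under averaging. -/
structure HasTameGradient (F : Submodule ℝ E) (m M L : ℝ) (f : E → ℝ) (a : E → F) : Prop where
  lower : ∀ x, m ≤ f x
  upper : ∀ x, f x ≤ M
  lipschitz : ∀ x y, |f x - f y| ≤ L * ‖x - y‖
  norm_le : ∀ x, ‖a x‖ ≤ L
  grad_lipschitz : ∀ x y, ‖a x - a y‖ ≤ L * ‖x - y‖
  taylor : ∀ x h, |f (x + h) - f x - ⟪(a x : E), h⟫| ≤ L * ‖h‖ ^ 2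

namespace HasTameGradient

variable {F : Submodule ℝ E} {m M L : ℝ} {f : E → ℝ} {a : E → F}

theorem nonneg (h : HasTameGradient F m M L f a) : 0 ≤ L :=
  (norm_nonneg _).trans (h.norm_le 0)

theorem mono (h : HasTameGradient F m M L f a) {L' : ℝ} (hL : L ≤ L') :
    HasTameGradient F m M L' f a where
  lower := h.lower
  upper := h.upper
  lipschitz x y := (h.lipschitz x y).trans (by gcongr)
  norm_le x := (h.norm_le x).trans hL
  grad_lipschitz x y := (h.grad_lipschitz x y).trans (by gcongr)
  taylor x y := (h.taylor x y).trans (by gcongr)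

theorem continuous (h : HasTameGradient F m M L f a) : Continuous f :=
  (LipschitzWith.of_dist_le_mul (K := ⟨L, h.nonneg⟩) fun x y ↦ by
    rw [dist_eq_norm, dist_eq_norm]; exact h.lipschitz x y).continuous

theorem continuous_grad (h : HasTameGradient F m M L f a) : Continuous a :=
  (LipschitzWith.of_dist_le_mul (K := ⟨L, h.nonneg⟩) fun x y ↦ by
    rw [dist_eq_norm, dist_eq_norm]; exact h.grad_lipschitz x y).continuous

theorem norm_apply_le (h : HasTameGradient F m M L f a) (hm : 0 ≤ m) (x : E) : ‖f x‖ ≤ M := by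
  rw [Real.norm_eq_abs, abs_of_nonneg (hm.trans (h.lower x))]
  exact h.upper x

end HasTameGradient

section Bump

variable [FiniteDimensional ℝ E]

open scoped Manifold ContDiff in
theorem exists_contDiff_hasCompactSupport_eq_one {C U : Set E} (hC : IsCompact C) (hU : IsOpen U)
    (hCU : C ⊆ U) :
    ∃ g : E → ℝ, ContDiff ℝ 2 g ∧ HasCompactSupport g ∧ (∀ x ∈ C, g x = 1) ∧ (∀ x ∉ U, g x = 0) ∧
      ∀ x, g x ∈ Set.Icc 0 1 := by
  obtain ⟨V, hV, hCV, hVc⟩ := exists_isOpen_superset_and_isCompact_closure hC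
  obtain ⟨g, h0, h1, h01⟩ := exists_contMDiffMap_zero_one_of_isClosed (n := 2) 𝓘(ℝ, E)
    (hU.inter hV).isClosed_compl hC.isClosed
    (Set.disjoint_left.2 fun x hx hxC ↦ hx ⟨hCU hxC, hCV hxC⟩)
  refine ⟨g, g.contMDiff.contDiff, HasCompactSupport.intro hVc fun x hx ↦ ?_, fun x hx ↦ h1 hx,
    fun x hx ↦ h0 fun h ↦ hx h.1, h01⟩
  exact h0 fun h ↦ hx (subset_closure h.2)

theorem ContDiff.exists_gradient_bounds {g : E → ℝ} (hg : ContDiff ℝ 2 g)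
    (hs : HasCompactSupport g) :
    ∃ (L : ℝ) (a : E → E), 0 ≤ L ∧ (∀ x y, |g x - g y| ≤ L * ‖x - y‖) ∧ (∀ x, ‖a x‖ ≤ L) ∧
      (∀ x y, ‖a x - a y‖ ≤ L * ‖x - y‖) ∧
      ∀ x h, |g (x + h) - g x - ⟪a x, h⟫| ≤ L * ‖h‖ ^ 2 := by
  obtain ⟨L₁, h1⟩ := ContDiff.lipschitzWith_of_hasCompactSupport hs hg two_ne_zero
  obtain ⟨L₂, h2⟩ := ContDiff.lipschitzWith_of_hasCompactSupport (hs.fderiv ℝ)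
    (hg.fderiv_right (m := 1) (by norm_num)) one_ne_zero
  have hd : Differentiable ℝ g := hg.differentiable two_ne_zero
  have h2' : ∀ x y, ‖fderiv ℝ g x - fderiv ℝ g y‖ ≤ L₂ * ‖x - y‖ := fun x y ↦ by
    rw [← dist_eq_norm, ← dist_eq_norm]; exact h2.dist_le_mul x y
  have hL₁ : (L₁ : ℝ) ≤ L₁ + L₂ := le_add_of_nonneg_right L₂.2
  have hL₂ : (L₂ : ℝ) ≤ L₁ + L₂ := le_add_of_nonneg_left L₁.2
  refine ⟨L₁ + L₂, gradient g, add_nonneg L₁.2 L₂.2, fun x y ↦ ?_, fun x ↦ ?_, fun x y ↦ ?_,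
    fun x h ↦ ?_⟩
  · rw [← Real.dist_eq, ← dist_eq_norm]
    exact (h1.dist_le_mul _ _).trans (by gcongr)
  · rw [gradient, LinearIsometryEquiv.norm_map]
    exact (norm_fderiv_le_of_lipschitz ℝ h1).trans hL₁
  · rw [gradient, gradient, ← map_sub, LinearIsometryEquiv.norm_map]
    exact (h2' x y).trans (by gcongr)
  · have key := (convex_closedBall x ‖h‖).norm_image_sub_le_of_norm_fderiv_le' (𝕜 := ℝ)
      (f := g) (φ := fderiv ℝ g x) (C := L₂ * ‖h‖) (x := x) (y := x + h)
      (fun y _ ↦ hd y) (fun y hy ↦ ?_) (by simp) (by simp)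
    · rw [gradient, InnerProductSpace.toDual_symm_apply]
      rw [add_sub_cancel_left, Real.norm_eq_abs] at key
      refine key.trans ?_
      rw [mul_assoc, ← sq]
      gcongr
    · refine (h2' y x).trans ?_
      rw [Metric.mem_closedBall, dist_eq_norm] at hy
      gcongr

/-- A compactly supported `C²` function with values in `[0, 1]` on the subspace `F`, composed with
the orthogonal projection and shifted to be bounded below, is regular in the sense of
`HasTameGradient`. -/
theorem ContDiff.exists_hasTameGradient {F : Submodule ℝ E} {g : F → ℝ} (hg : ContDiff ℝ 2 g)
    (hs : HasCompactSupport g) (h01 : ∀ x, g x ∈ Set.Icc 0 1) :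
    ∃ (L : ℝ) (a : E → F), ∀ ε,
      HasTameGradient F ε (1 + ε) L (fun x ↦ ε + g (F.orthogonalProjectionOnto x)) a := by
  obtain ⟨L, a, hL, h1, h2, h3, h4⟩ := hg.exists_gradient_bounds hs
  have hP : ∀ x, ‖F.orthogonalProjectionOnto x‖ ≤ ‖x‖ := F.norm_orthogonalProjectionOnto_apply_le
  refine ⟨L, fun x ↦ a (F.orthogonalProjectionOnto x), fun ε ↦ ⟨fun x ↦ ?_, fun x ↦ ?_,
    fun x y ↦ ?_, fun x ↦ h2 _, fun x y ↦ ?_, fun x h ↦ ?_⟩⟩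
  · linarith [(h01 (F.orthogonalProjectionOnto x)).1]
  · linarith [(h01 (F.orthogonalProjectionOnto x)).2]
  · rw [add_sub_add_left_eq_sub]
    refine (h1 _ _).trans ?_
    rw [← map_sub]
    exact mul_le_mul_of_nonneg_left (hP _) hL
  · refine (h3 _ _).trans ?_
    rw [← map_sub]
    exact mul_le_mul_of_nonneg_left (hP _) hL
  · rw [map_add, add_sub_add_left_eq_sub, ← Submodule.inner_orthogonalProjectionOnto_eq_of_mem_left]
    refine (h4 _ _).trans ?_
    exact mul_le_mul_of_nonneg_left (pow_le_pow_left₀ (norm_nonneg _) (hP h) 2) hL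

end Bump

/-! ### Gaussian averages -/

variable [FiniteDimensional ℝ E] [MeasurableSpace E] [BorelSpace E]

/-- The heat semigroup at time `σ ^ 2 / 2`: the average of `f` over a Gaussian of standard
deviation `σ` centred at `x`. -/
noncomputable def gaussAvg {G : Type*} [NormedAddCommGroup G] [NormedSpace ℝ G]
    (σ : ℝ) (f : E → G) (x : E) : G :=
  ∫ z, f (x + σ • z) ∂(stdGaussian E)

theorem integrable_gaussAvg {G : Type*} [NormedAddCommGroup G] [NormedSpace ℝ G]
    [FiniteDimensional ℝ G] {f : E → G} (hf : Continuous f) {C : ℝ} (hC : ∀ x, ‖f x‖ ≤ C)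
    (σ : ℝ) (x : E) : Integrable (fun z ↦ f (x + σ • z)) (stdGaussian E) :=
  Integrable.of_bound (by
    have := FiniteDimensional.proper_real G
    exact (by fun_prop : Continuous fun z ↦ f (x + σ • z)).aestronglyMeasurable) C
    (ae_of_all _ fun z ↦ hC _)

theorem integrable_const_add_norm_pow (κ : ℝ) (k : ℕ) :
    Integrable (fun z : E ↦ (‖z‖ + κ) ^ k) (stdGaussian E) := by
  rcases Nat.eq_zero_or_pos k with rfl | hk
  · simp
  have h1 : MemLp (fun z : E ↦ ‖z‖) k (stdGaussian E) :=
    (IsGaussian.memLp_id (stdGaussian E) k (by simp)).norm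
  have h2 : MemLp (fun z : E ↦ ‖z‖ + κ) k (stdGaussian E) := h1.add (memLp_const κ)
  refine (h2.integrable_norm_pow hk.ne').mono (by fun_prop) (ae_of_all _ fun z ↦ ?_)
  simp

theorem integrable_norm_stdGaussian : Integrable (fun z : E ↦ ‖z‖) (stdGaussian E) := by
  simpa using integrable_const_add_norm_pow (E := E) 0 1

theorem integrable_norm_sq_stdGaussian : Integrable (fun z : E ↦ ‖z‖ ^ 2) (stdGaussian E) := by
  simpa using integrable_const_add_norm_pow (E := E) 0 2

theorem integrable_inner_stdGaussian (v : E) :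
    Integrable (fun z : E ↦ ⟪v, z⟫) (stdGaussian E) :=
  (integrable_norm_stdGaussian.const_mul ‖v‖).mono (by fun_prop) (ae_of_all _ fun z ↦ by
    simpa using norm_inner_le_norm (𝕜 := ℝ) v z)

theorem integrable_inner_sq_stdGaussian (v : E) :
    Integrable (fun z : E ↦ ⟪v, z⟫ ^ 2) (stdGaussian E) :=
  (integrable_norm_sq_stdGaussian.const_mul (‖v‖ ^ 2)).mono (by fun_prop) (ae_of_all _ fun z ↦ by
    have := pow_le_pow_left₀ (norm_nonneg _) (norm_inner_le_norm (𝕜 := ℝ) v z) 2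
    simpa [mul_pow] using this)

theorem integral_inner_stdGaussian (v : E) : ∫ z, ⟪v, z⟫ ∂(stdGaussian E) = 0 :=
  integral_strongDual_stdGaussian (innerSL ℝ v)

theorem integral_inner_sq_stdGaussian (v : E) : ∫ z, ⟪v, z⟫ ^ 2 ∂(stdGaussian E) = ‖v‖ ^ 2 := by
  have h := variance_dual_stdGaussian (innerSL ℝ v)
  rw [variance_of_integral_eq_zero (by fun_prop) (integral_strongDual_stdGaussian _),
    innerSL_apply_norm] at h
  exact h

/-- Variances add under convolution of centred isotropic Gaussians. -/
theorem map_smul_stdGaussian_conv {σ τ ρ : ℝ} (h : σ ^ 2 + τ ^ 2 = ρ ^ 2) :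
    ((stdGaussian E).map (σ • ·)) ∗ ((stdGaussian E).map (τ • ·)) =
      (stdGaussian E).map (ρ • ·) := by
  have h1 : IsProbabilityMeasure ((stdGaussian E).map (σ • ·)) :=
    Measure.isProbabilityMeasure_map (by fun_prop)
  have h2 : IsProbabilityMeasure ((stdGaussian E).map (τ • ·)) :=
    Measure.isProbabilityMeasure_map (by fun_prop)
  have h3 : IsProbabilityMeasure ((stdGaussian E).map (ρ • ·)) :=
    Measure.isProbabilityMeasure_map (by fun_prop)
  refine Measure.ext_of_charFun (funext fun t ↦ ?_)
  rw [charFun_conv, charFun_map_smul, charFun_map_smul, charFun_map_smul, charFun_stdGaussian,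
    charFun_stdGaussian, charFun_stdGaussian, ← Complex.exp_add, norm_smul, norm_smul, norm_smul]
  congr 1
  rw [← Complex.ofReal_pow, ← Complex.ofReal_pow, ← Complex.ofReal_pow, mul_pow, mul_pow, mul_pow,
    Real.norm_eq_abs, Real.norm_eq_abs, Real.norm_eq_abs, sq_abs, sq_abs, sq_abs, ← h]
  push_cast
  ring

/-- The semigroup property of the heat flow. -/
theorem gaussAvg_gaussAvg {f : E → ℝ} (hf : Continuous f) {C : ℝ} (hC : ∀ x, ‖f x‖ ≤ C)
    {σ τ ρ : ℝ} (h : σ ^ 2 + τ ^ 2 = ρ ^ 2) (x : E) :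
    gaussAvg σ (gaussAvg τ f) x = gaussAvg ρ f x := by
  have h1 : IsProbabilityMeasure ((stdGaussian E).map (σ • ·)) :=
    Measure.isProbabilityMeasure_map (by fun_prop)
  have h2 : IsProbabilityMeasure ((stdGaussian E).map (τ • ·)) :=
    Measure.isProbabilityMeasure_map (by fun_prop)
  have e : ∀ y : E, ∫ z, f (x + z) ∂((stdGaussian E).map (ρ • ·)) = gaussAvg ρ f x := fun _ ↦ by
    rw [gaussAvg, integral_map (by fun_prop) (by fun_prop)]
  rw [← e 0, ← map_smul_stdGaussian_conv h, integral_conv, integral_map (by fun_prop)]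
  · unfold gaussAvg
    refine integral_congr_ae (ae_of_all _ fun z ↦ ?_)
    simp only
    rw [integral_map (by fun_prop) (by fun_prop)]
    simp only [add_assoc]
  · refine Continuous.aestronglyMeasurable ?_
    refine continuous_of_dominated (bound := fun _ ↦ C) (fun z ↦ by fun_prop)
      (fun z ↦ ae_of_all _ fun w ↦ hC _) (integrable_const C) (ae_of_all _ fun w ↦ by fun_prop)
  · exact Integrable.of_bound (by fun_prop) C (ae_of_all _ fun z ↦ hC _)

theorem continuous_gaussAvg {f : E → ℝ} (hf : Continuous f) {C : ℝ} (hC : ∀ x, ‖f x‖ ≤ C)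
    (σ : ℝ) : Continuous (gaussAvg σ f) :=
  continuous_of_dominated (bound := fun _ ↦ C) (fun z ↦ by fun_prop)
    (fun z ↦ ae_of_all _ fun w ↦ hC _) (integrable_const C) (ae_of_all _ fun w ↦ by fun_prop)

theorem norm_gaussAvg_le {G : Type*} [NormedAddCommGroup G] [NormedSpace ℝ G]
    {f : E → G} {C : ℝ} (hC : ∀ x, ‖f x‖ ≤ C) (σ : ℝ) (x : E) : ‖gaussAvg σ f x‖ ≤ C := by
  simpa [gaussAvg] using norm_integral_le_of_norm_le_const (μ := stdGaussian E)
    (ae_of_all _ fun z ↦ hC (x + σ • z))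

namespace HasTameGradient

variable {F : Submodule ℝ E} {m M L : ℝ} {f : E → ℝ} {a : E → F}

theorem integrable (h : HasTameGradient F m M L f a) (hm : 0 ≤ m) (σ : ℝ) (x : E) :
    Integrable (fun z ↦ f (x + σ • z)) (stdGaussian E) :=
  integrable_gaussAvg h.continuous (h.norm_apply_le hm) σ x

theorem le_gaussAvg (h : HasTameGradient F m M L f a) (hm : 0 ≤ m) (σ : ℝ) (x : E) :
    m ≤ gaussAvg σ f x := by
  simpa [_root_.gaussAvg] using integral_mono (integrable_const m) (h.integrable hm σ x) fun z ↦ h.lower _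

theorem gaussAvg_le (h : HasTameGradient F m M L f a) (hm : 0 ≤ m) (σ : ℝ) (x : E) :
    gaussAvg σ f x ≤ M := by
  simpa [_root_.gaussAvg] using integral_mono (h.integrable hm σ x) (integrable_const M) fun z ↦ h.upper _

/-- Averaging preserves the regularity constants, and the gradient of the average is the average of
the gradients. -/
theorem gaussAvg (h : HasTameGradient F m M L f a) (hm : 0 ≤ m) (σ : ℝ) :
    HasTameGradient F m M L (gaussAvg σ f) (gaussAvg σ a) where
  lower := h.le_gaussAvg hm σ
  upper := h.gaussAvg_le hm σ
  lipschitz x y := by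
    unfold _root_.gaussAvg
    rw [← integral_sub (h.integrable hm σ x) (h.integrable hm σ y)]
    have := norm_integral_le_of_norm_le_const (μ := stdGaussian E) (C := L * ‖x - y‖)
      (f := fun z ↦ f (x + σ • z) - f (y + σ • z))
      (ae_of_all _ fun z ↦ by
        have := h.lipschitz (x + σ • z) (y + σ • z)
        rwa [add_sub_add_right_eq_sub] at this)
    rwa [probReal_univ, mul_one] at this
  norm_le x := norm_gaussAvg_le h.norm_le σ x
  grad_lipschitz x y := by
    unfold _root_.gaussAvg
    rw [← integral_sub (integrable_gaussAvg h.continuous_grad h.norm_le σ x)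
      (integrable_gaussAvg h.continuous_grad h.norm_le σ y)]
    have := norm_integral_le_of_norm_le_const (μ := stdGaussian E) (C := L * ‖x - y‖)
      (f := fun z ↦ a (x + σ • z) - a (y + σ • z))
      (ae_of_all _ fun z ↦ by
        have := h.grad_lipschitz (x + σ • z) (y + σ • z)
        rwa [add_sub_add_right_eq_sub] at this)
    rwa [probReal_univ, mul_one] at this
  taylor x v := by
    have hi := integrable_gaussAvg h.continuous_grad h.norm_le σ x
    have e : ⟪((_root_.gaussAvg σ a x : F) : E), v⟫ =
        ∫ z, ⟪(a (x + σ • z) : E), v⟫ ∂(stdGaussian E) := by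
      have h1 := ((innerSL ℝ v).comp F.subtypeL).integral_comp_comm hi
      simp only [ContinuousLinearMap.comp_apply, Submodule.subtypeL_apply,
        innerSL_apply_apply] at h1
      simp only [real_inner_comm v]
      exact h1.symm
    have hi' : Integrable (fun z ↦ ⟪(a (x + σ • z) : E), v⟫) (stdGaussian E) := by
      have := ((innerSL ℝ v).comp F.subtypeL).integrable_comp hi
      simpa [real_inner_comm v] using this
    rw [e]
    unfold _root_.gaussAvg
    rw [← integral_sub (h.integrable hm σ _) (h.integrable hm σ x), ← integral_sub _ hi']
    · have := norm_integral_le_of_norm_le_const (μ := stdGaussian E) (C := L * ‖v‖ ^ 2)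
        (f := fun z ↦ f (x + v + σ • z) - f (x + σ • z) - ⟪(a (x + σ • z) : E), v⟫)
        (ae_of_all _ fun z ↦ by
          have := h.taylor (x + σ • z) v
          rwa [add_right_comm] at this)
      simpa using this
    · exact (h.integrable hm σ _).sub (h.integrable hm σ x)

/-- The deviation of `f` from its Gaussian average is of first order in `σ`. -/
theorem abs_sub_gaussAvg_le (h : HasTameGradient F m M L f a) (hm : 0 ≤ m) {σ : ℝ} (hσ : 0 ≤ σ)
    (x z : E) :
    |f (x + σ • z) - _root_.gaussAvg σ f x| ≤
      L * σ * (‖z‖ + ∫ w, ‖w‖ ∂(stdGaussian E)) := by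
  have hi := h.integrable hm σ x
  have e : f (x + σ • z) - _root_.gaussAvg σ f x =
      ∫ w, (f (x + σ • z) - f (x + σ • w)) ∂(stdGaussian E) := by
    rw [integral_sub (integrable_const _) hi]
    simp [_root_.gaussAvg]
  have e2 : L * σ * (‖z‖ + ∫ w, ‖w‖ ∂(stdGaussian E)) =
      ∫ w, L * σ * (‖z‖ + ‖w‖) ∂(stdGaussian E) := by
    rw [integral_const_mul, integral_add (integrable_const _) integrable_norm_stdGaussian]
    simp
  rw [e, e2, ← Real.norm_eq_abs]
  refine norm_integral_le_of_norm_le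
    (((integrable_const _).add integrable_norm_stdGaussian).const_mul _) (ae_of_all _ fun w ↦ ?_)
  refine (h.lipschitz _ _).trans ?_
  rw [add_sub_add_left_eq_sub, ← smul_sub, norm_smul, Real.norm_of_nonneg hσ, mul_assoc]
  have := norm_sub_le z w
  have := h.nonneg
  gcongr

/-- The deviation of `f` from its Gaussian average is linear up to second order in `σ`: the linear
Taylor term does not contribute to the average, since the Gaussian is centred. -/
theorem abs_sub_gaussAvg_sub_inner_le (h : HasTameGradient F m M L f a) (hm : 0 ≤ m) {σ : ℝ}
    (x z : E) :
    |f (x + σ • z) - _root_.gaussAvg σ f x - σ * ⟪(a x : E), z⟫| ≤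
      L * σ ^ 2 * (‖z‖ ^ 2 + ∫ w, ‖w‖ ^ 2 ∂(stdGaussian E)) := by
  have hi := h.integrable hm σ x
  have hT : ∀ w, |f (x + σ • w) - f x - σ * ⟪(a x : E), w⟫| ≤ L * σ ^ 2 * ‖w‖ ^ 2 := fun w ↦ by
    have := h.taylor x (σ • w)
    rwa [norm_smul, mul_pow, Real.norm_eq_abs, sq_abs, ← mul_assoc, inner_smul_right] at this
  have e : _root_.gaussAvg σ f x - f x =
      ∫ w, (f (x + σ • w) - f x - σ * ⟪(a x : E), w⟫) ∂(stdGaussian E) := by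
    have hi' : Integrable (fun w ↦ f (x + σ • w) - f x) (stdGaussian E) :=
      hi.sub (integrable_const _)
    rw [integral_sub hi' ((integrable_inner_stdGaussian _).const_mul _), integral_sub hi (integrable_const _),
      integral_const_mul, integral_inner_stdGaussian]
    simp [_root_.gaussAvg]
  have h2 : |_root_.gaussAvg σ f x - f x| ≤ L * σ ^ 2 * ∫ w, ‖w‖ ^ 2 ∂(stdGaussian E) := by
    rw [e, ← Real.norm_eq_abs, ← integral_const_mul]
    exact norm_integral_le_of_norm_le (integrable_norm_sq_stdGaussian.const_mul _)
      (ae_of_all _ hT)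
  have h3 := hT z
  rw [abs_le] at *
  constructor <;> linarith [h2.1, h2.2, h3.1, h3.2]

end HasTameGradient

/-! ### The Gaussian Brascamp-Lieb inequality by discrete heat flow -/

/-- One small time step of the heat flow: averaging a weighted geometric mean of functions whose
gradients lie in the subspaces `F i` gives at most the geometric mean of the averages, up to a
relative error of third order in the standard deviation. The first order terms vanish on averaging
and the second order term is nonpositive by `norm_sum_smul_sq_le`. -/
theorem exists_gaussAvg_prod_rpow_le {ι : Type*} [Fintype ι] {F : ι → Submodule ℝ E}
    {c : ι → ℝ} (hc : ∀ i, 0 ≤ c i) (hF : ∀ x, ∑ i, c i • (F i).starProjection x = x)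
    {m M L : ℝ} (hm : 0 < m) (hM : 0 ≤ M) (hL : 0 ≤ L) :
    ∃ K : ℝ, 0 ≤ K ∧ ∀ (σ : ℝ), 0 ≤ σ → ∀ (f : ι → E → ℝ) (a : ∀ i, E → F i),
      (∀ i, HasTameGradient (F i) m M L (f i) (a i)) → ∀ x,
      gaussAvg σ (fun y ↦ ∏ i, f i y ^ c i) x ≤
        (1 + K * σ ^ 3) * ∏ i, gaussAvg σ (f i) x ^ c i := by
  obtain ⟨D, hD, hDle⟩ := exists_prod_one_add_rpow_le c hc (M / m) (by positivity)
  set κ₁ := ∫ w, ‖w‖ ∂(stdGaussian E)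
  set κ₂ := ∫ w, ‖w‖ ^ 2 ∂(stdGaussian E)
  have hκ₁ : 0 ≤ κ₁ := integral_nonneg fun _ ↦ norm_nonneg _
  have hκ₂ : 0 ≤ κ₂ := integral_nonneg fun _ ↦ by positivity
  -- A single length scale `‖z‖ + κ` that controls all the error terms.
  set κ := 1 + κ₁ + κ₂ with hκ
  set S := ∑ i, c i with hS
  have hS0 : 0 ≤ S := Finset.sum_nonneg fun i _ ↦ hc i
  set C := L / m with hC
  have hC0 : 0 ≤ C := by positivity
  set W := ∫ z : E, (‖z‖ + κ) ^ 3 ∂(stdGaussian E)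
  have hW : 0 ≤ W := integral_nonneg fun z ↦ by positivity
  set R := (2 * S ^ 2 * C ^ 2 + 2 * S * C ^ 2) / 2 + D * C ^ 3 with hR
  refine ⟨R * W, by positivity, fun σ hσ f a hf x ↦ ?_⟩
  set p : ι → ℝ := fun i ↦ gaussAvg σ (f i) x with hp
  have hpm : ∀ i, m ≤ p i := fun i ↦ (hf i).le_gaussAvg hm.le σ x
  have hp0 : ∀ i, 0 < p i := fun i ↦ hm.trans_le (hpm i)
  have hpM : ∀ i, p i ≤ M := fun i ↦ (hf i).gaussAvg_le hm.le σ x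
  set θ : ι → E → ℝ := fun i z ↦ (f i (x + σ • z) - p i) / p i with hθ
  set b : ∀ i, F i := fun i ↦ (p i)⁻¹ • a i x with hb
  have hθ1 : ∀ i z, 1 + θ i z = f i (x + σ • z) / p i := fun i z ↦ by
    have := (hp0 i).ne'
    simp only [hθ]; field_simp; ring
  have hθpos : ∀ i z, -1 < θ i z := fun i z ↦ by
    have : 0 < 1 + θ i z := by
      rw [hθ1]; exact div_pos (hm.trans_le ((hf i).lower _)) (hp0 i)
    linarith
  have hdiv : ∀ i (u B : ℝ), 0 ≤ B → |u| ≤ B → |u / p i| ≤ B / m := fun i u B hB hu ↦ by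
    rw [abs_div, abs_of_pos (hp0 i)]
    exact div_le_div₀ hB hu hm (hpm i)
  have hθw : ∀ i z, |θ i z| ≤ C * (σ * (‖z‖ + κ)) := fun i z ↦ by
    refine (hdiv i _ _ (by positivity) ((hf i).abs_sub_gaussAvg_le hm.le hσ x z)).trans ?_
    have h1 : ‖z‖ + κ₁ ≤ ‖z‖ + κ := by linarith
    calc L * σ * (‖z‖ + κ₁) / m = C * (σ * (‖z‖ + κ₁)) := by rw [hC]; ring
      _ ≤ _ := by gcongr
  have hθM : ∀ i z, |θ i z| ≤ M / m := fun i z ↦ by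
    refine hdiv i _ _ hM ?_
    have h1 := (hf i).lower (x + σ • z)
    have h2 := (hf i).upper (x + σ • z)
    have h3 := hpm i
    have h4 := hpM i
    rw [abs_le]; constructor <;> linarith
  have hlin : ∀ i z, |θ i z - σ * ⟪(b i : E), z⟫| ≤ C * (σ * (‖z‖ + κ)) ^ 2 := fun i z ↦ by
    have e : θ i z - σ * ⟪(b i : E), z⟫ =
        (f i (x + σ • z) - p i - σ * ⟪(a i x : E), z⟫) / p i := by
      simp only [hθ, hb, Submodule.coe_smul, real_inner_smul_left]
      ring
    rw [e]
    refine (hdiv i _ _ (by positivity)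
      ((hf i).abs_sub_gaussAvg_sub_inner_le hm.le x z)).trans ?_
    have h1 : ‖z‖ ^ 2 + κ₂ ≤ (‖z‖ + κ) ^ 2 := by
      have := norm_nonneg z
      nlinarith [mul_nonneg this hκ₁, mul_nonneg this hκ₂, mul_nonneg hκ₁ hκ₂]
    calc L * σ ^ 2 * (‖z‖ ^ 2 + κ₂) / m = C * (σ ^ 2 * (‖z‖ ^ 2 + κ₂)) := by rw [hC]; ring
      _ ≤ C * (σ ^ 2 * (‖z‖ + κ) ^ 2) := by gcongr
      _ = _ := by ring
  have hin : ∀ i z, |σ * ⟪(b i : E), z⟫| ≤ C * (σ * (‖z‖ + κ)) := fun i z ↦ by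
    have e : σ * ⟪(b i : E), z⟫ = (σ * ⟪(a i x : E), z⟫) / p i := by
      simp only [hb, Submodule.coe_smul, real_inner_smul_left]
      ring
    have h1 : |σ * ⟪(a i x : E), z⟫| ≤ L * (σ * (‖z‖ + κ)) := by
      rw [abs_mul, abs_of_nonneg hσ]
      have h2 := abs_real_inner_le_norm (a i x : E) z
      have h3 : ‖(a i x : E)‖ ≤ L := (hf i).norm_le x
      have h4 : ‖z‖ ≤ ‖z‖ + κ := by linarith
      calc σ * |⟪(a i x : E), z⟫| ≤ σ * (L * (‖z‖ + κ)) := by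
            gcongr
            exact h2.trans (by gcongr)
        _ = _ := by ring
    rw [e]
    refine (hdiv i _ _ (by positivity) h1).trans_eq ?_
    rw [hC]; ring
  -- The second order term, whose average is nonpositive.
  set Q : E → ℝ := fun z ↦ ⟪∑ i, c i • (b i : E), z⟫ ^ 2 - ∑ i, c i * ⟪(b i : E), z⟫ ^ 2 with hQ
  have hQint : Integrable Q (stdGaussian E) :=
    (integrable_inner_sq_stdGaussian _).sub
      (integrable_finsetSum _ fun i _ ↦ (integrable_inner_sq_stdGaussian _).const_mul _)
  have hQle : ∫ z, Q z ∂(stdGaussian E) ≤ 0 := by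
    rw [hQ, integral_sub (integrable_inner_sq_stdGaussian _)
      (integrable_finsetSum _ fun i _ ↦ (integrable_inner_sq_stdGaussian _).const_mul _),
      integral_finsetSum _ fun i _ ↦ (integrable_inner_sq_stdGaussian _).const_mul _]
    simp only [integral_const_mul, integral_inner_sq_stdGaussian]
    exact sub_nonpos.2 (norm_sum_smul_sq_le hc hF b)
  have hθint : ∀ i, Integrable (θ i) (stdGaussian E) := fun i ↦
    (((hf i).integrable hm.le σ x).sub (integrable_const _)).div_const _
  have hθzero : ∀ i, ∫ z, θ i z ∂(stdGaussian E) = 0 := fun i ↦ by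
    simp only [hθ]
    rw [integral_div, integral_sub ((hf i).integrable hm.le σ x) (integrable_const _)]
    simp [hp, gaussAvg]
  have hpt : ∀ z, ∏ i, (1 + θ i z) ^ c i ≤
      1 + ∑ i, c i * θ i z + σ ^ 2 / 2 * Q z + R * σ ^ 3 * (‖z‖ + κ) ^ 3 := fun z ↦ by
    set w := σ * (‖z‖ + κ) with hw
    have hw0 : 0 ≤ w := by positivity
    -- The bound by `M / m` keeps `D` independent of `σ` and `z`; the bound by `C * w` makes the
    -- error cubic in `σ`.
    have h1 := hDle (fun i ↦ θ i z) (min (C * w) (M / m)) (fun i ↦ hθpos i z)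
      (fun i ↦ le_min (hθw i z) (hθM i z)) (le_min (by positivity) (by positivity))
      (min_le_right _ _)
    have h2 : D * min (C * w) (M / m) ^ 3 ≤ D * C ^ 3 * w ^ 3 := by
      have : min (C * w) (M / m) ^ 3 ≤ (C * w) ^ 3 :=
        pow_le_pow_left₀ (le_min (by positivity) (by positivity)) (min_le_left _ _) 3
      calc _ ≤ D * (C * w) ^ 3 := by gcongr
        _ = _ := by ring
    have e1 : σ * ⟪∑ i, c i • (b i : E), z⟫ = ∑ i, c i * (σ * ⟪(b i : E), z⟫) := by
      rw [sum_inner, Finset.mul_sum]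
      exact Finset.sum_congr rfl fun i _ ↦ by rw [real_inner_smul_left]; ring
    set A := ∑ i, c i * θ i z with hA
    set α := σ * ⟪∑ i, c i • (b i : E), z⟫ with hα
    have hsum : ∀ (u : ι → ℝ) (B : ℝ), (∀ i, |u i| ≤ B) → |∑ i, c i * u i| ≤ S * B := by
      intro u B hu
      rw [hS, Finset.sum_mul]
      refine (Finset.abs_sum_le_sum_abs _ _).trans (Finset.sum_le_sum fun i _ ↦ ?_)
      rw [abs_mul, abs_of_nonneg (hc i)]
      exact mul_le_mul_of_nonneg_left (hu i) (hc i)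
    have h3 : |A - α| ≤ S * (C * w ^ 2) := by
      rw [e1, hA, ← Finset.sum_sub_distrib]
      simp only [← mul_sub]
      exact hsum _ _ fun i ↦ hlin i z
    have h4 : |A + α| ≤ S * (C * (w + w)) := by
      rw [e1, hA, ← Finset.sum_add_distrib]
      simp only [← mul_add]
      exact hsum _ _ fun i ↦ (abs_add_le _ _).trans
        ((add_le_add (hθw i z) (hin i z)).trans_eq (mul_add _ _ _).symm)
    -- Replacing `θ i` by its linearization changes the quadratic terms by `O(w ^ 3)`.
    have h5 : A ^ 2 ≤ α ^ 2 + 2 * S ^ 2 * C ^ 2 * w ^ 3 := by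
      have : |(A - α) * (A + α)| ≤ (S * (C * w ^ 2)) * (S * (C * (w + w))) := by
        rw [abs_mul]; exact mul_le_mul h3 h4 (abs_nonneg _) (by positivity)
      have := (le_abs_self _).trans this
      linear_combination this
    have h6 : σ ^ 2 * ∑ i, c i * ⟪(b i : E), z⟫ ^ 2 ≤
        ∑ i, c i * θ i z ^ 2 + 2 * S * C ^ 2 * w ^ 3 := by
      have h7 : |∑ i, c i * ((σ * ⟪(b i : E), z⟫) ^ 2 - θ i z ^ 2)| ≤
          S * ((C * w ^ 2) * (C * w + C * w)) := by
        refine hsum _ _ fun i ↦ ?_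
        rw [sq_sub_sq, abs_mul, mul_comm]
        refine mul_le_mul ?_ ?_ (abs_nonneg _) (by positivity)
        · rw [abs_sub_comm]; exact hlin i z
        · exact (abs_add_le _ _).trans (add_le_add (hin i z) (hθw i z))
      have h8 := (le_abs_self _).trans h7
      simp only [mul_sub, Finset.sum_sub_distrib] at h8
      rw [Finset.mul_sum]
      have e2 : ∀ i, σ ^ 2 * (c i * ⟪(b i : E), z⟫ ^ 2) = c i * (σ * ⟪(b i : E), z⟫) ^ 2 :=
        fun i ↦ by ring
      simp only [e2]
      linear_combination h8
    have e3 : σ ^ 2 / 2 * Q z = (α ^ 2 - σ ^ 2 * ∑ i, c i * ⟪(b i : E), z⟫ ^ 2) / 2 := by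
      rw [hQ, hα]; ring
    have e4 : R * σ ^ 3 * (‖z‖ + κ) ^ 3 =
        (2 * S ^ 2 * C ^ 2 * w ^ 3 + 2 * S * C ^ 2 * w ^ 3) / 2 + D * C ^ 3 * w ^ 3 := by
      rw [hR, hw]; ring
    rw [e3, e4]
    linarith
  have hcont : Continuous fun z ↦ ∏ i, (1 + θ i z) ^ c i := by
    refine continuous_finsetProd _ fun i _ ↦ ?_
    refine Continuous.rpow_const ?_ fun z ↦ Or.inr (hc i)
    simp only [hθ1]
    have := (hf i).continuous
    fun_prop
  have hint1 : Integrable (fun z ↦ ∑ i, c i * θ i z) (stdGaussian E) :=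
    integrable_finsetSum _ fun i _ ↦ (hθint i).const_mul _
  have hint3 : Integrable (fun z : E ↦ R * σ ^ 3 * (‖z‖ + κ) ^ 3) (stdGaussian E) :=
    (integrable_const_add_norm_pow κ 3).const_mul _
  have hint12 := ((integrable_const (1 : ℝ) (μ := stdGaussian E)).add hint1).add
    (hQint.const_mul (σ ^ 2 / 2))
  have hint0 : Integrable (fun z ↦ ∏ i, (1 + θ i z) ^ c i) (stdGaussian E) := by
    refine (hint12.add hint3).mono' hcont.aestronglyMeasurable (ae_of_all _ fun z ↦ ?_)
    rw [Real.norm_of_nonneg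
      (Finset.prod_nonneg fun i _ ↦ Real.rpow_nonneg (by linarith [hθpos i z]) _)]
    exact hpt z
  have hfin : ∫ z, ∏ i, (1 + θ i z) ^ c i ∂(stdGaussian E) ≤ 1 + R * W * σ ^ 3 := by
    have h := integral_mono hint0 (hint12.add hint3) hpt
    refine h.trans ?_
    have e : ∫ z, ((((fun _ ↦ (1 : ℝ)) + fun z ↦ ∑ i, c i * θ i z) +
        fun z ↦ σ ^ 2 / 2 * Q z) + fun z : E ↦ R * σ ^ 3 * (‖z‖ + κ) ^ 3 : E → ℝ) z ∂(stdGaussian E) =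
        1 + σ ^ 2 / 2 * ∫ z, Q z ∂(stdGaussian E) + R * σ ^ 3 * W := by
      rw [integral_add' hint12 hint3, integral_add' ((integrable_const _).add hint1)
        (hQint.const_mul _), integral_add' (integrable_const _) hint1,
        integral_const_mul, integral_const_mul, integral_finsetSum _
        fun i _ ↦ (hθint i).const_mul _]
      simp [integral_const_mul, hθzero, W]
    rw [e]
    nlinarith [mul_nonneg (sq_nonneg σ) (neg_nonneg.2 hQle)]
  have hprod : ∀ z, ∏ i, f i (x + σ • z) ^ c i =
      (∏ i, (1 + θ i z) ^ c i) * ∏ i, p i ^ c i := fun z ↦ by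
    rw [← Finset.prod_mul_distrib]
    refine Finset.prod_congr rfl fun i _ ↦ ?_
    rw [← Real.mul_rpow (by linarith [hθpos i z]) (hp0 i).le, hθ1, div_mul_cancel₀ _ (hp0 i).ne']
  rw [gaussAvg]
  simp only [hprod]
  rw [integral_mul_const]
  exact mul_le_mul_of_nonneg_right hfin
    (Finset.prod_nonneg fun i _ ↦ Real.rpow_nonneg (hp0 i).le _)

/-- Iterating `k` small time steps of the heat flow. -/
theorem gaussAvg_sqrt_mul_prod_rpow_le {ι : Type*} [Fintype ι] {F : ι → Submodule ℝ E}
    {c : ι → ℝ} (hc : ∀ i, 0 ≤ c i) {m M L ε σ : ℝ} (hm : 0 < m) (hε : 0 ≤ ε)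
    (hstep : ∀ (f : ι → E → ℝ) (a : ∀ i, E → F i),
      (∀ i, HasTameGradient (F i) m M L (f i) (a i)) → ∀ x,
      gaussAvg σ (fun y ↦ ∏ i, f i y ^ c i) x ≤ (1 + ε) * ∏ i, gaussAvg σ (f i) x ^ c i)
    {f : ι → E → ℝ} {a : ∀ i, E → F i} (hf : ∀ i, HasTameGradient (F i) m M L (f i) (a i))
    (k : ℕ) (x : E) :
    gaussAvg (√k * σ) (fun y ↦ ∏ i, f i y ^ c i) x ≤
      (1 + ε) ^ k * ∏ i, gaussAvg (√k * σ) (f i) x ^ c i := by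
  induction k generalizing x with
  | zero => simp [gaussAvg]
  | succ k ih =>
    have hs : σ ^ 2 + (√k * σ) ^ 2 = (√(k + 1 : ℕ) * σ) ^ 2 := by
      rw [mul_pow, mul_pow, Real.sq_sqrt (by positivity), Real.sq_sqrt (by positivity)]
      push_cast; ring
    have hcont : ∀ g : ι → E → ℝ, (∀ i, ∃ a, HasTameGradient (F i) m M L (g i) a) →
        Continuous fun y ↦ ∏ i, g i y ^ c i := fun g hg ↦
      continuous_finsetProd _ fun i _ ↦ by
        obtain ⟨a, ha⟩ := hg i
        exact ha.continuous.rpow_const fun z ↦ Or.inr (hc i)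
    have hbdd : ∀ g : ι → E → ℝ, (∀ i, ∃ a, HasTameGradient (F i) m M L (g i) a) →
        ∀ y, ‖∏ i, g i y ^ c i‖ ≤ ∏ i : ι, M ^ c i := fun g hg y ↦ by
      have hp : ∀ i, 0 ≤ g i y := fun i ↦ by
        obtain ⟨a, ha⟩ := hg i
        exact hm.le.trans (ha.lower y)
      rw [Real.norm_of_nonneg (Finset.prod_nonneg fun i _ ↦ Real.rpow_nonneg (hp i) _)]
      refine Finset.prod_le_prod (fun i _ ↦ Real.rpow_nonneg (hp i) _) fun i _ ↦ ?_
      obtain ⟨a, ha⟩ := hg i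
      exact Real.rpow_le_rpow (hp i) (ha.upper y) (hc i)
    have hf' : ∀ i, ∃ a, HasTameGradient (F i) m M L (f i) a := fun i ↦ ⟨_, hf i⟩
    have hg := fun i ↦ (hf i).gaussAvg hm.le (√k * σ)
    have hg' : ∀ i, ∃ a, HasTameGradient (F i) m M L (gaussAvg (√k * σ) (f i)) a :=
      fun i ↦ ⟨_, hg i⟩
    rw [← gaussAvg_gaussAvg (hcont f hf') (hbdd f hf') hs]
    have h1 : gaussAvg σ (gaussAvg (√k * σ) fun y ↦ ∏ i, f i y ^ c i) x ≤
        (1 + ε) ^ k * gaussAvg σ (fun y ↦ ∏ i, gaussAvg (√k * σ) (f i) y ^ c i) x := by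
      conv_rhs => rw [gaussAvg, ← integral_const_mul]
      refine integral_mono ?_ ?_ fun z ↦ ih _
      · exact integrable_gaussAvg (continuous_gaussAvg (hcont f hf') (hbdd f hf') _)
          (norm_gaussAvg_le (hbdd f hf') _) σ x
      · exact (integrable_gaussAvg (hcont _ hg') (hbdd _ hg') σ x).const_mul _
    refine h1.trans ?_
    have h2 := hstep _ _ hg x
    simp only [fun i ↦ gaussAvg_gaussAvg (hf i).continuous ((hf i).norm_apply_le hm.le) hs x] at h2
    rw [pow_succ, mul_assoc]
    gcongr

/-- The Gaussian form of the geometric Brascamp-Lieb inequality, for regular functions. -/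
theorem integral_prod_rpow_le {ι : Type*} [Fintype ι] {F : ι → Submodule ℝ E}
    {c : ι → ℝ} (hc : ∀ i, 0 ≤ c i) (hF : ∀ x, ∑ i, c i • (F i).starProjection x = x)
    {m M L : ℝ} (hm : 0 < m) (hM : 0 ≤ M) (hL : 0 ≤ L)
    {f : ι → E → ℝ} {a : ∀ i, E → F i} (hf : ∀ i, HasTameGradient (F i) m M L (f i) (a i)) :
    ∫ x, ∏ i, f i x ^ c i ∂(stdGaussian E) ≤ ∏ i, (∫ x, f i x ∂(stdGaussian E)) ^ c i := by
  obtain ⟨K, hK, hstep⟩ := exists_gaussAvg_prod_rpow_le hc hF hm hM hL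
  have hP : 0 ≤ ∏ i, (∫ x, f i x ∂(stdGaussian E)) ^ c i :=
    Finset.prod_nonneg fun i _ ↦ Real.rpow_nonneg
      (integral_nonneg fun x ↦ hm.le.trans ((hf i).lower x)) _
  have key : ∀ N : ℕ, 0 < N → ∫ x, ∏ i, f i x ^ c i ∂(stdGaussian E) ≤
      Real.exp (K * (√N)⁻¹) * ∏ i, (∫ x, f i x ∂(stdGaussian E)) ^ c i := by
    intro N hN
    have hN' : (0 : ℝ) < N := by exact_mod_cast hN
    have hs : 0 < √(N : ℝ) := Real.sqrt_pos.2 hN'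
    have h := gaussAvg_sqrt_mul_prod_rpow_le (σ := (√N)⁻¹) (ε := K * (√N)⁻¹ ^ 3) hc hm
      (by positivity) (fun f a hf x ↦ hstep _ (by positivity) f a hf x) hf N 0
    simp only [mul_inv_cancel₀ hs.ne', gaussAvg, one_smul, zero_add] at h
    refine h.trans (mul_le_mul_of_nonneg_right ?_ hP)
    have h1 : 1 + K * (√N)⁻¹ ^ 3 ≤ Real.exp (K * (√N)⁻¹ ^ 3) := by
      linarith [Real.add_one_le_exp (K * (√(N : ℝ))⁻¹ ^ 3)]
    -- `N` steps with relative error `K / √N ^ 3` each.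
    refine (pow_le_pow_left₀ (by positivity) h1 N).trans_eq ?_
    rw [← Real.exp_nat_mul]
    congr 1
    have : (N : ℝ) = √N * √N := (Real.mul_self_sqrt hN'.le).symm
    nth_rw 1 [this]
    field_simp
  have hlim : Tendsto (fun N : ℕ ↦ Real.exp (K * (√(N : ℝ))⁻¹) *
      ∏ i, (∫ x, f i x ∂(stdGaussian E)) ^ c i) atTop
      (𝓝 (Real.exp (K * 0) * ∏ i, (∫ x, f i x ∂(stdGaussian E)) ^ c i)) := by
    refine Tendsto.mul_const _ ((Real.continuous_exp.tendsto _).comp (Tendsto.const_mul _ ?_))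
    exact tendsto_inv_atTop_zero.comp (Real.tendsto_sqrt_atTop.comp tendsto_natCast_atTop_atTop)
  rw [mul_zero, Real.exp_zero, one_mul] at hlim
  exact ge_of_tendsto hlim (eventually_gt_atTop 0 |>.mono key)

theorem map_orthogonalProjectionOnto_stdGaussian (F : Submodule ℝ E) :
    (stdGaussian E).map F.orthogonalProjectionOnto = stdGaussian F := by
  have h : IsProbabilityMeasure ((stdGaussian E).map F.orthogonalProjectionOnto) :=
    Measure.isProbabilityMeasure_map (by fun_prop)
  refine Measure.ext_of_charFun (funext fun t ↦ ?_)
  have e := charFun_stdGaussian (t : E)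
  rw [charFun_apply] at e
  rw [charFun_stdGaussian, charFun_apply, integral_map (by fun_prop) (by fun_prop),
    show ‖t‖ = ‖(t : E)‖ from rfl, ← e]
  simp only [Submodule.inner_orthogonalProjectionOnto_eq_of_mem_right]

/-- The Gaussian form of the geometric Brascamp-Lieb inequality, for the indicator functions of
the projections of a compact set. -/
theorem stdGaussian_real_le_prod {ι : Type*} [Fintype ι] {F : ι → Submodule ℝ E}
    {c : ι → ℝ} (hc : ∀ i, 0 ≤ c i) (hF : ∀ x, ∑ i, c i • (F i).starProjection x = x)
    {K : Set E} (hK : IsCompact K) :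
    (stdGaussian E).real K ≤
      ∏ i, (stdGaussian (F i)).real ((F i).orthogonalProjectionOnto '' K) ^ c i := by
  have hPK : ∀ i, IsCompact ((F i).orthogonalProjectionOnto '' K) := fun i ↦
    hK.image (F i).orthogonalProjectionOnto.continuous
  have key : ∀ ε : ℝ, 0 < ε → (stdGaussian E).real K ≤
      ∏ i, ((stdGaussian (F i)).real ((F i).orthogonalProjectionOnto '' K) + 2 * ε) ^ c i := by
    intro ε hε
    have hU : ∀ i, ∃ U, (F i).orthogonalProjectionOnto '' K ⊆ U ∧ IsOpen U ∧
        (stdGaussian (F i)).real U ≤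
          (stdGaussian (F i)).real ((F i).orthogonalProjectionOnto '' K) + ε := fun i ↦ by
      obtain ⟨U, h1, h2, h3⟩ := Set.exists_isOpen_lt_add (μ := stdGaussian (F i))
        ((F i).orthogonalProjectionOnto '' K) (measure_ne_top _ _)
        (ENNReal.ofReal_pos.2 hε).ne'
      refine ⟨U, h1, h2, ?_⟩
      have := ENNReal.toReal_mono (by finiteness) h3.le
      rwa [ENNReal.toReal_add (by finiteness) (by finiteness),
        ENNReal.toReal_ofReal hε.le] at this
    choose U hKU hUo hUle using hU
    choose g hg hgs hg1 hg0 hg01 using fun i ↦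
      exists_contDiff_hasCompactSupport_eq_one (hPK i) (hUo i) (hKU i)
    choose L a hL using fun i ↦ (hg i).exists_hasTameGradient (hgs i) (hg01 i)
    have hL0 : ∀ i, 0 ≤ L i := fun i ↦ (hL i ε).nonneg
    -- The functions must share one regularity constant; the sum of the individual ones serves.
    have hf := fun i ↦ (hL i ε).mono
      (Finset.single_le_sum (fun j _ ↦ hL0 j) (Finset.mem_univ i))
    have main := integral_prod_rpow_le hc hF hε (by positivity)
      (Finset.sum_nonneg fun i _ ↦ hL0 i) hf
    set f : ι → E → ℝ := fun i x ↦ ε + g i ((F i).orthogonalProjectionOnto x) with hfdef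
    have hf0 : ∀ i x, 0 ≤ f i x := fun i x ↦ hε.le.trans ((hf i).lower x)
    have hcont : Continuous fun x ↦ ∏ i, f i x ^ c i := continuous_finsetProd _ fun i _ ↦
      (hf i).continuous.rpow_const fun z ↦ Or.inr (hc i)
    have hprod0 : ∀ x, 0 ≤ ∏ i, f i x ^ c i := fun x ↦
      Finset.prod_nonneg fun i _ ↦ Real.rpow_nonneg (hf0 i x) _
    have hint : Integrable (fun x ↦ ∏ i, f i x ^ c i) (stdGaussian E) := by
      refine Integrable.of_bound hcont.aestronglyMeasurable (∏ i, (1 + ε) ^ c i)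
        (ae_of_all _ fun x ↦ ?_)
      rw [Real.norm_of_nonneg (hprod0 x)]
      exact Finset.prod_le_prod (fun i _ ↦ Real.rpow_nonneg (hf0 i x) _) fun i _ ↦
        Real.rpow_le_rpow (hf0 i x) ((hf i).upper x) (hc i)
    have h1 : (stdGaussian E).real K ≤ ∫ x, ∏ i, f i x ^ c i ∂(stdGaussian E) := by
      rw [← integral_indicator_one hK.measurableSet]
      refine integral_mono ((integrable_const (1 : ℝ)).indicator hK.measurableSet) hint fun x ↦ ?_
      by_cases hx : x ∈ K
      · rw [Set.indicator_of_mem hx, Pi.one_apply]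
        refine Finset.one_le_prod fun i _ ↦ Real.one_le_rpow ?_ (hc i)
        simp only [hfdef]
        rw [hg1 i _ (Set.mem_image_of_mem _ hx)]
        linarith
      · rw [Set.indicator_of_notMem hx]
        exact hprod0 x
    refine h1.trans (main.trans ?_)
    refine Finset.prod_le_prod (fun i _ ↦ Real.rpow_nonneg (integral_nonneg (hf0 i)) _)
      fun i _ ↦ Real.rpow_le_rpow (integral_nonneg (hf0 i)) ?_ (hc i)
    have hgi : Integrable (g i) (stdGaussian (F i)) :=
      Integrable.of_bound (hg i).continuous.aestronglyMeasurable 1 (ae_of_all _ fun x ↦ by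
        rw [Real.norm_of_nonneg (hg01 i x).1]; exact (hg01 i x).2)
    have h2 : ∫ x, f i x ∂(stdGaussian E) = ε + ∫ y, g i y ∂(stdGaussian (F i)) := by
      rw [← map_orthogonalProjectionOnto_stdGaussian, integral_map (by fun_prop)
        (hg i).continuous.aestronglyMeasurable]
      simp only [hfdef]
      rw [integral_add (integrable_const _)]
      · simp
      · rw [← map_orthogonalProjectionOnto_stdGaussian] at hgi
        exact hgi.comp_measurable (by fun_prop)
    have h3 : ∫ y, g i y ∂(stdGaussian (F i)) ≤ (stdGaussian (F i)).real (U i) := by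
      rw [← integral_indicator_one (hUo i).measurableSet]
      refine integral_mono hgi ((integrable_const (1 : ℝ)).indicator (hUo i).measurableSet)
        fun y ↦ ?_
      by_cases hy : y ∈ U i
      · rw [Set.indicator_of_mem hy]; exact (hg01 i y).2
      · rw [Set.indicator_of_notMem hy, hg0 i y hy]
    linarith [hUle i]
  have hlim : Tendsto (fun ε : ℝ ↦
      ∏ i, ((stdGaussian (F i)).real ((F i).orthogonalProjectionOnto '' K) + 2 * ε) ^ c i)
      (𝓝[>] 0) (𝓝 (∏ i, ((stdGaussian (F i)).real
        ((F i).orthogonalProjectionOnto '' K) + 2 * 0) ^ c i)) := by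
    refine Tendsto.mono_left (Continuous.tendsto ?_ 0) nhdsWithin_le_nhds
    exact continuous_finsetProd _ fun i _ ↦
      Continuous.rpow_const (by fun_prop) fun z ↦ Or.inr (hc i)
  simp only [mul_zero, add_zero] at hlim
  exact ge_of_tendsto hlim (eventually_mem_nhdsWithin.mono key)

/-! ### From the Gaussian to the Lebesgue measure -/

open scoped Pointwise

/-- The density of the standard Gaussian measure with respect to the Lebesgue measure. -/
theorem stdGaussian_eq_withDensity :
    stdGaussian E = (volume : Measure E).withDensity fun x ↦
      ENNReal.ofReal ((√(2 * Real.pi))⁻¹ ^ Module.finrank ℝ E * Real.exp (-(1 / 2) * ‖x‖ ^ 2)) := by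
  set A : ℝ := (√(2 * Real.pi))⁻¹ ^ Module.finrank ℝ E with hA
  have hA0 : 0 < A := by positivity
  have hAc : (A : ℂ) * ((Real.pi : ℂ) / ((1 / 2 : ℝ) : ℂ)) ^ (Module.finrank ℝ E / 2 : ℂ) = 1 := by
    have h1 : ((Real.pi : ℂ) / ((1 / 2 : ℝ) : ℂ)) ^ (Module.finrank ℝ E / 2 : ℂ) =
        ((2 * Real.pi) ^ ((Module.finrank ℝ E : ℝ) / 2) : ℝ) := by
      rw [Complex.ofReal_cpow (by positivity)]
      push_cast
      congr 1
      ring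
    have h2 : (2 * Real.pi) ^ ((Module.finrank ℝ E : ℝ) / 2) =
        √(2 * Real.pi) ^ Module.finrank ℝ E := by
      rw [Real.sqrt_eq_rpow, ← Real.rpow_natCast, ← Real.rpow_mul (by positivity)]
      congr 1
      ring
    rw [h1, h2, hA, ← Complex.ofReal_mul, ← mul_pow, inv_mul_cancel₀ (by positivity)]
    simp
  -- A function with nonzero Bochner integral is integrable.
  have hint : Integrable (fun x : E ↦ A * Real.exp (-(1 / 2) * ‖x‖ ^ 2)) := by
    refine Integrable.const_mul (Integrable.of_integral_ne_zero ?_) _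
    rw [GaussianFourier.integral_rexp_neg_mul_sq_norm (by norm_num)]
    positivity
  have hfin := isFiniteMeasure_withDensity_ofReal hint.2
  refine Measure.ext_of_charFun (funext fun t ↦ ?_)
  rw [charFun_stdGaussian, charFun_apply, integral_withDensity_eq_integral_toReal_smul
    (by fun_prop) (ae_of_all _ fun _ ↦ ENNReal.ofReal_lt_top)]
  have e : ∀ x : E, (ENNReal.ofReal (A * Real.exp (-(1 / 2) * ‖x‖ ^ 2))).toReal •
      Complex.exp (⟪x, t⟫ * Complex.I) =
      A * Complex.exp (-((1 / 2 : ℝ) : ℂ) * ‖x‖ ^ 2 + Complex.I * ⟪t, x⟫) := fun x ↦ by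
    rw [ENNReal.toReal_ofReal (by positivity), Complex.real_smul, Complex.ofReal_mul,
      Complex.ofReal_exp, mul_assoc, ← Complex.exp_add, real_inner_comm]
    push_cast
    congr 3
    ring
  simp only [e]
  rw [integral_const_mul, GaussianFourier.integral_cexp_neg_mul_sq_norm_add
    (by norm_num), ← mul_assoc, hAc, one_mul, Complex.I_sq]
  congr 1
  push_cast
  ring

theorem volume_real_smul (l : ℝ) (hl : 0 < l) (K : Set E) :
    (volume : Measure E).real (l • K) = l ^ Module.finrank ℝ E * (volume : Measure E).real K := by
  rw [measureReal_def, Measure.addHaar_smul, ENNReal.toReal_mul,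
    ENNReal.toReal_ofReal (abs_nonneg _), abs_of_pos (by positivity), measureReal_def]

theorem stdGaussian_real_smul_le {C : Set E} (hC : IsCompact C) {l : ℝ} (hl : 0 < l) :
    (stdGaussian E).real (l • C) ≤
      ((√(2 * Real.pi))⁻¹ * l) ^ Module.finrank ℝ E * (volume : Measure E).real C := by
  have hm : MeasurableSet (l • C) := (hC.smul l).measurableSet
  rw [mul_pow, mul_assoc, ← volume_real_smul l hl, measureReal_def, measureReal_def,
    stdGaussian_eq_withDensity, withDensity_apply _ hm]
  set A : ℝ := (√(2 * Real.pi))⁻¹ ^ Module.finrank ℝ E with hA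
  have hA0 : 0 < A := by positivity
  rw [← ENNReal.toReal_ofReal hA0.le, ← ENNReal.toReal_mul]
  refine ENNReal.toReal_mono
    (ENNReal.mul_ne_top ENNReal.ofReal_ne_top (hC.smul l).measure_lt_top.ne) ?_
  rw [← setLIntegral_const, ENNReal.toReal_ofReal hA0.le]
  refine lintegral_mono fun x ↦ ENNReal.ofReal_le_ofReal ?_
  refine mul_le_of_le_one_right hA0.le (Real.exp_le_one_iff.2 ?_)
  nlinarith [sq_nonneg ‖x‖]

theorem le_stdGaussian_real_smul {K : Set E} (hK : IsCompact K) {ρ : ℝ}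
    (hρ : ∀ x ∈ K, ‖x‖ ≤ ρ) {l : ℝ} (hl : 0 < l) :
    ((√(2 * Real.pi))⁻¹ * l) ^ Module.finrank ℝ E * (volume : Measure E).real K *
      Real.exp (-(1 / 2) * (l * ρ) ^ 2) ≤ (stdGaussian E).real (l • K) := by
  have hm : MeasurableSet (l • K) := (hK.smul l).measurableSet
  have hρ' : ∀ x ∈ l • K, ‖x‖ ≤ l * ρ := by
    rintro _ ⟨x, hx, rfl⟩
    simp only [norm_smul, Real.norm_of_nonneg hl.le]
    have := hρ x hx
    gcongr
  rw [mul_pow, mul_assoc _ (l ^ _), ← volume_real_smul l hl, mul_right_comm, measureReal_def,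
    measureReal_def]
  set A : ℝ := (√(2 * Real.pi))⁻¹ ^ Module.finrank ℝ E with hA
  have hA0 : 0 < A := by positivity
  have hB : 0 ≤ A * Real.exp (-(1 / 2) * (l * ρ) ^ 2) := by positivity
  rw [← ENNReal.toReal_ofReal hB, ← ENNReal.toReal_mul]
  refine ENNReal.toReal_mono (measure_ne_top _ _) ?_
  rw [stdGaussian_eq_withDensity, withDensity_apply _ hm, ← setLIntegral_const]
  refine setLIntegral_mono (by fun_prop) fun x hx ↦ ENNReal.ofReal_le_ofReal ?_
  have := hρ' x hx
  have : ‖x‖ ^ 2 ≤ (l * ρ) ^ 2 := by gcongr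
  refine mul_le_mul_of_nonneg_left (Real.exp_le_exp.2 ?_) hA0.le
  linarith

/-- The geometric Brascamp-Lieb inequality for a compact set and its projections. On small sets
the Gaussian measure is asymptotically proportional to the Lebesgue measure, so the inequality
follows from the Gaussian one by shrinking the set. -/
theorem volume_real_le_prod {ι : Type*} [Fintype ι] {F : ι → Submodule ℝ E}
    {c : ι → ℝ} (hc : ∀ i, 0 ≤ c i) (hF : ∀ x, ∑ i, c i • (F i).starProjection x = x)
    {K : Set E} (hK : IsCompact K) :
    (volume : Measure E).real K ≤
      ∏ i, (volume : Measure (F i)).real ((F i).orthogonalProjectionOnto '' K) ^ c i := by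
  obtain ⟨ρ, hρ⟩ := hK.isBounded.exists_norm_le
  set V := ∏ i, (volume : Measure (F i)).real ((F i).orthogonalProjectionOnto '' K) ^ c i with hV
  have key : ∀ l : ℝ, 0 < l →
      (volume : Measure E).real K * Real.exp (-(1 / 2) * (l * ρ) ^ 2) ≤ V := by
    intro l hl
    set A := (√(2 * Real.pi))⁻¹ * l with hA
    have hA0 : 0 < A := by positivity
    have h1 := le_stdGaussian_real_smul hK hρ hl
    have h2 := stdGaussian_real_le_prod hc hF (hK.smul l)
    have h3 : ∏ i, (stdGaussian (F i)).real ((F i).orthogonalProjectionOnto '' (l • K)) ^ c i ≤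
        ∏ i, (A ^ Module.finrank ℝ (F i) *
          (volume : Measure (F i)).real ((F i).orthogonalProjectionOnto '' K)) ^ c i := by
      refine Finset.prod_le_prod (fun i _ ↦ Real.rpow_nonneg measureReal_nonneg _) fun i _ ↦
        Real.rpow_le_rpow measureReal_nonneg ?_ (hc i)
      rw [image_smul_set]
      exact stdGaussian_real_smul_le (hK.image (F i).orthogonalProjectionOnto.continuous) hl
    -- The normalizing factors combine to `A ^ ∑ c i * dim (F i) = A ^ dim E`.
    have h4 : ∏ i, (A ^ Module.finrank ℝ (F i) *
          (volume : Measure (F i)).real ((F i).orthogonalProjectionOnto '' K)) ^ c i =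
        A ^ Module.finrank ℝ E * V := by
      rw [hV, ← Real.rpow_natCast, ← sum_mul_finrank_eq hF, Real.rpow_sum_of_pos hA0,
        ← Finset.prod_mul_distrib]
      refine Finset.prod_congr rfl fun i _ ↦ ?_
      rw [Real.mul_rpow (by positivity) measureReal_nonneg, ← Real.rpow_natCast,
        ← Real.rpow_mul hA0.le, mul_comm (c i)]
    have h5 := h1.trans (h2.trans (h3.trans_eq h4))
    rw [mul_assoc] at h5
    exact le_of_mul_le_mul_left h5 (by positivity)
  have hlim : Tendsto (fun l : ℝ ↦
      (volume : Measure E).real K * Real.exp (-(1 / 2) * (l * ρ) ^ 2)) (𝓝[>] 0)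
      (𝓝 ((volume : Measure E).real K * Real.exp (-(1 / 2) * (0 * ρ) ^ 2))) :=
    Tendsto.mono_left (Continuous.tendsto (by fun_prop) 0) nhdsWithin_le_nhds
  simp only [zero_mul, ne_eq, OfNat.ofNat_ne_zero, not_false_eq_true, zero_pow, mul_zero,
    Real.exp_zero, mul_one] at hlim
  exact le_of_tendsto hlim (eventually_mem_nhdsWithin.mono key)

end BrascampLieb

theorem theorem2p1 {n r : ℕ} (F : Fin r → Submodule ℝ (EuclideanSpace ℝ (Fin n)))
    (s : ℝ) (c : Fin r → ℝ) (hF : IsUniformCover F s c)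
    (K : Set (EuclideanSpace ℝ (Fin n))) (hK : IsCompact K) :
    (MeasureTheory.volume K) ^ s ≤
      ∏ i, (MeasureTheory.volume ((F i).orthogonalProjectionOnto '' K)) ^ c i := by
  have hs := hF.pos
  have hc : ∀ i, 0 ≤ c i / s := fun i ↦ (div_pos (hF.weight_pos i) hs).le
  have hid : ∀ x, ∑ i, (c i / s) • (F i).starProjection x = x := fun x ↦ by
    have h := congrArg (fun T ↦ s⁻¹ • T x) hF.sum_eq
    simp only [_root_.smul_apply, ContinuousLinearMap.id_apply,
      _root_.sum_apply, Finset.smul_sum, smul_smul, inv_mul_cancel₀ hs.ne',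
      one_smul] at h
    rw [eq_comm]
    simpa only [div_eq_inv_mul] using h
  have hPK : ∀ i, volume ((F i).orthogonalProjectionOnto '' K) ≠ ∞ := fun i ↦
    (hK.image (F i).orthogonalProjectionOnto.continuous).measure_lt_top.ne
  have h := ENNReal.ofReal_le_ofReal (volume_real_le_prod hc hid hK)
  rw [ofReal_measureReal hK.measure_lt_top.ne, ENNReal.ofReal_prod_of_nonneg
    fun i _ ↦ Real.rpow_nonneg measureReal_nonneg _] at h
  have e : ∀ i, ENNReal.ofReal
      ((volume : Measure (F i)).real ((F i).orthogonalProjectionOnto '' K) ^ (c i / s)) =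
      volume ((F i).orthogonalProjectionOnto '' K) ^ (c i / s) := fun i ↦ by
    rw [← ENNReal.ofReal_rpow_of_nonneg measureReal_nonneg (hc i), ofReal_measureReal (hPK i)]
  simp only [e] at h
  refine (ENNReal.rpow_le_rpow h hs.le).trans_eq ?_
  rw [← ENNReal.prod_rpow_of_nonneg hs.le]
  refine Finset.prod_congr rfl fun i _ ↦ ?_
  rw [← ENNReal.rpow_mul, div_mul_cancel₀ _ hs.ne']
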